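/- Consider a game with players $1,\dots,N$. Player $i$ chooses $x_i$ in a nonempty set $K_i\subseteq\mathbb R^n$ and has the cost $f_i(x_i,\bar x)$, where $\bar x=\sum_{j=1}^N x_j$ is the aggregate decision. Put $K=\prod_{i=1}^N K_i$, $\bar K=\sum_{i=1}^N K_i$ (Minkowski sum) and $\bar x_{-i}=\sum_{j\ne i}x_j$, so that, given the other players' decisions, player $i$ minimizes $z\mapsto f_i(z,z+\bar x_{-i})$ over $z\in K_i$. A point $x^*\in K$ is a Nash equilibrium if, for every $i$, $f_i(x_i^*,x_i^*+\bar x^*_{-i})\le f_i(z,z+\bar x^*_{-i})$ for all $z\in K_i$. Suppose that 1. for every $i$, the set $K_i$ is compact and convex, the function $f_i(x_i,y)$ is continuously differentiable in $(x_i,y)$ on some open set containing $K_i\times\bar K$, and, for every $x\in K$, the function $z\mapsto f_i(z,z+\bar x_{-i})$ is convex on $K_i$; 2. the map $\phi=(\phi_1,\dots,\phi_N):K\to\mathbb R^{nN}$, where $\phi_i(x)$ is the gradient at $z=x_i$ of $z\mapsto f_i(z,z+\bar x_{-i})$, is strictly monotone on $K$, that is, $(\phi(x)-\phi(x'))^T(x-x')>0$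 for all $x,x'\in K$ with $x\neq x'$. Then the game has a unique Nash equilibrium. Moreover, the variational inequality $\mathrm{VI}(K,\phi)$, which asks for $x^*\in K$ such that $(x-x^*)^T\phi(x^*)\ge 0$ for all $x\in K$, has a unique solution, and a point is a Nash equilibrium if and only if it solves $\mathrm{VI}(K,\phi)$. -/

import Mathlib

open scoped Pointwise

/-- The data of an aggregative game with `N` players deciding in `ℝⁿ`: the strategy sets `K i` and
the cost functions `f i (x_i, x̄)`. Only the behaviour of `f i` near `K i × (∑ j, K j)` matters. -/
structure AggregativeGame (n N : ℕ) where
  K : Fin N → Set (EuclideanSpace ℝ (Fin n))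
  f : Fin N → EuclideanSpace ℝ (Fin n) → EuclideanSpace ℝ (Fin n) → ℝ

namespace AggregativeGame

variable {n N : ℕ}

/-- The joint strategy set `K = ∏ i, K i`. -/
def jointSet (G : AggregativeGame n N) : Set (Fin N → EuclideanSpace ℝ (Fin n)) :=
  Set.univ.pi G.K

/-- The Minkowski sum `K̄ = ∑ i, K i`. -/
def aggregateSet (G : AggregativeGame n N) : Set (EuclideanSpace ℝ (Fin n)) :=
  ∑ i, G.K i

/-- The aggregate `x̄_{-i} = ∑ j ≠ i, x j` of the decisions of all players other than `i`. -/
def aggregateOthers (x : Fin N → EuclideanSpace ℝ (Fin n)) (i : Fin N) :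
    EuclideanSpace ℝ (Fin n) :=
  ∑ j ∈ Finset.univ.erase i, x j

/-- The cost `z ↦ f i (z, z + x̄_{-i})` of player `i` as a function of its own decision, when the
other players play according to `x`. -/
def ownCost (G : AggregativeGame n N) (i : Fin N) (x : Fin N → EuclideanSpace ℝ (Fin n)) :
    EuclideanSpace ℝ (Fin n) → ℝ :=
  fun z => G.f i z (z + aggregateOthers x i)

/-- The map `φ`, whose `i`-th block is the gradient of player `i`'s cost in its own decision. -/
noncomputable def phi (G : AggregativeGame n N) (x : Fin N → EuclideanSpace ℝ (Fin n)) :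
    Fin N → EuclideanSpace ℝ (Fin n) :=
  fun i => gradient (G.ownCost i x) (x i)

/-- The strategy sets are nonempty, compact and convex, each `f i` is `C¹` on an open set
containing `K i × K̄`, and each player's cost is convex in the player's own decision. -/
structure IsConvexSmooth (G : AggregativeGame n N) : Prop where
  nonempty : ∀ i, (G.K i).Nonempty
  isCompact : ∀ i, IsCompact (G.K i)
  convex : ∀ i, Convex ℝ (G.K i)
  contDiffOn : ∀ i, ∃ U : Set (EuclideanSpace ℝ (Fin n) × EuclideanSpace ℝ (Fin n)),
    IsOpen U ∧ G.K i ×ˢ G.aggregateSet ⊆ U ∧ ContDiffOn ℝ 1 (Function.uncurry (G.f i)) U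
  convexOn : ∀ i, ∀ x ∈ G.jointSet, ConvexOn ℝ (G.K i) (G.ownCost i x)

/-- `φ` is strictly monotone over `K`; the inner product of `ℝ^{nN}` is written blockwise. -/
def IsStrictlyMonotone (G : AggregativeGame n N) : Prop :=
  ∀ x ∈ G.jointSet, ∀ y ∈ G.jointSet, x ≠ y →
    0 < ∑ i, inner ℝ (G.phi x i - G.phi y i) (x i - y i)

/-- `x` is a Nash equilibrium: no player can lower its cost by deviating alone. -/
def IsNashEquilibrium (G : AggregativeGame n N) (x : Fin N → EuclideanSpace ℝ (Fin n)) : Prop :=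
  x ∈ G.jointSet ∧ ∀ i, IsMinOn (G.ownCost i x) (G.K i) (x i)

/-- `x` solves the variational inequality `VI(K, φ)`. -/
def IsVISolution (G : AggregativeGame n N) (x : Fin N → EuclideanSpace ℝ (Fin n)) : Prop :=
  x ∈ G.jointSet ∧ ∀ y ∈ G.jointSet, 0 ≤ ∑ i, inner ℝ (y i - x i) (G.phi x i)

end AggregativeGame

/-! Convexity turns each player's optimality into a first-order condition; summing over players
gives the variational inequality, and deviations in one block recover the separate conditions. Two
distinct solutions, tested against each other, contradict strict monotonicity. Existence needs no
fixed-point theorem: the Minty inequalities are closed in the unknown, so compactness reduces them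
to finite systems, solved by Hahn–Banach separation and monotonicity. Continuity then leads back to
the variational inequality. -/

open Set

section VariationalInequality

variable {V : Type*} [AddCommGroup V] [Module ℝ V] [TopologicalSpace V]

/-- Finite systems of Minty inequalities of a monotone operator are solvable. -/
theorem exists_forall_finset_minty {K : Set V} (hne : K.Nonempty) (hc : IsCompact K)
    (hconv : Convex ℝ K) (Φ : V → V →L[ℝ] ℝ)
    (hmono : ∀ x ∈ K, ∀ y ∈ K, 0 ≤ (Φ x - Φ y) (x - y)) (s : Finset K) :
    ∃ x ∈ K, ∀ y ∈ s, 0 ≤ Φ y (y - x) := by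
  classical
  by_contra! hcon
  let T : V → (s → ℝ) := fun x k => Φ k.1 (k.1.1 - x)
  have hTcont : Continuous T := by
    refine continuous_pi fun k => ?_
    simp only [T, map_sub]
    exact continuous_const.sub (Φ k.1).continuous
  have hTconv : Convex ℝ (T '' K) := by
    rintro _ ⟨x, hx, rfl⟩ _ ⟨y, hy, rfl⟩ a b ha hb hab
    refine ⟨a • x + b • y, hconv hx hy ha hb hab, ?_⟩
    funext k
    simp only [T, map_sub, map_add, map_smul, smul_eq_mul, Pi.add_apply, Pi.smul_apply]
    linear_combination (-(Φ k.1 k.1.1)) * hab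
  have hdisj : Disjoint (T '' K) (Ici (0 : s → ℝ)) := by
    rw [Set.disjoint_left]
    rintro _ ⟨x, hx, rfl⟩ h0
    obtain ⟨y, hy, hlt⟩ := hcon x hx
    exact absurd (h0 ⟨y, hy⟩) (not_le.2 hlt)
  obtain ⟨f, u, v, hfu, huv, hvf⟩ := geometric_hahn_banach_compact_closed hTconv
    (hc.image hTcont) (convex_Ici 0) isClosed_Ici hdisj
  have hv0 : v < 0 := by simpa using hvf 0 (mem_Ici.2 le_rfl)
  let e : s → s → ℝ := fun k => Pi.single k 1
  have hμ : ∀ k, 0 ≤ f (e k) := by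
    intro k
    by_contra! hneg
    -- Scaled so that `f` takes exactly the value `v` here, against the strict bound `hvf`.
    have hmem : (v / f (e k)) • e k ∈ Ici (0 : s → ℝ) :=
      mem_Ici.2 (smul_nonneg (div_nonneg_of_nonpos hv0.le hneg.le)
        (Pi.single_nonneg.2 zero_le_one))
    have := hvf _ hmem
    rw [map_smul, smul_eq_mul, div_mul_cancel₀ _ hneg.ne] at this
    exact lt_irrefl _ this
  have hf : ∀ w : s → ℝ, f w = ∑ k, w k * f (e k) := by
    intro w
    conv_lhs => rw [pi_eq_sum_univ' w]
    simp only [map_sum, map_smul, smul_eq_mul]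
    rfl
  have hcol : ∀ j : s, f (T j.1.1) < 0 := fun j =>
    (hfu _ ⟨_, j.1.2, rfl⟩).trans (huv.trans hv0)
  obtain ⟨x₀, hx₀⟩ := hne
  have hpos : ∃ k, 0 < f (e k) := by
    by_contra! h
    have h0 : f (T x₀) = 0 := by
      rw [hf]
      exact Finset.sum_eq_zero fun k _ => by rw [le_antisymm (h k) (hμ k), mul_zero]
    have := hfu _ ⟨x₀, hx₀, rfl⟩
    linarith
  obtain ⟨k₀, hk₀⟩ := hpos
  have hlt : ∑ j, f (e j) * f (T j.1.1) < 0 :=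
    Finset.sum_neg' (fun j _ => mul_nonpos_of_nonneg_of_nonpos (hμ j) (hcol j).le)
      ⟨k₀, Finset.mem_univ _, mul_neg_of_pos_of_neg hk₀ (hcol k₀)⟩
  -- Separation makes the total of `S` negative; pairing `(j, k)` with `(k, j)` makes it nonnegative
  -- by monotonicity.
  let S : s → s → ℝ := fun j k => f (e j) * (T j.1.1 k * f (e k))
  have hS : ∑ j, f (e j) * f (T j.1.1) = ∑ j, ∑ k, S j k :=
    Finset.sum_congr rfl fun j _ => by rw [hf (T j.1.1), Finset.mul_sum]
  have hsym : 0 ≤ ∑ j, ∑ k, (S j k + S k j) := by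
    refine Finset.sum_nonneg fun j _ => Finset.sum_nonneg fun k _ => ?_
    have h := mul_nonneg (mul_nonneg (hμ j) (hμ k)) (hmono _ k.1.2 _ j.1.2)
    have heq : S j k + S k j = f (e j) * f (e k) * (Φ k.1 - Φ j.1) (k.1.1 - j.1.1) := by
      simp only [S, T, map_sub, _root_.sub_apply]
      ring
    rw [heq]
    exact h
  simp only [Finset.sum_add_distrib] at hsym
  rw [Finset.sum_comm (f := fun j k => S k j)] at hsym
  linarith

/-- A monotone operator on a nonempty compact convex set has a point satisfying all the Minty
inequalities. -/
theorem exists_forall_minty {K : Set V} (hne : K.Nonempty) (hc : IsCompact K)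
    (hconv : Convex ℝ K) (Φ : V → V →L[ℝ] ℝ)
    (hmono : ∀ x ∈ K, ∀ y ∈ K, 0 ≤ (Φ x - Φ y) (x - y)) :
    ∃ x ∈ K, ∀ y ∈ K, 0 ≤ Φ y (y - x) := by
  let M : K → Set V := fun y => {x | 0 ≤ Φ y (y - x)}
  have hclosed : ∀ y, IsClosed (M y) := fun y => by
    simp only [M, map_sub]
    exact isClosed_le continuous_const (continuous_const.sub (Φ y).continuous)
  obtain ⟨x, hx, hxM⟩ := hc.inter_iInter_nonempty M hclosed fun s => by
    obtain ⟨x, hx, h⟩ := exists_forall_finset_minty hne hc hconv Φ hmono s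
    exact ⟨x, hx, mem_iInter₂.2 h⟩
  exact ⟨x, hx, fun y hy => mem_iInter.1 hxM ⟨y, hy⟩⟩

/-- **Minty's lemma**: a solution of the Minty inequalities of a continuous operator solves the
variational inequality. -/
theorem variationalInequality_of_minty [ContinuousAdd V] [ContinuousSMul ℝ V] {K : Set V}
    (hconv : Convex ℝ K) (Φ : V → V →L[ℝ] ℝ) (hcont : ∀ v, ContinuousOn (fun x => Φ x v) K)
    {x : V} (hx : x ∈ K) (hminty : ∀ y ∈ K, 0 ≤ Φ y (y - x)) {y : V} (hy : y ∈ K) :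
    0 ≤ Φ x (y - x) := by
  let γ : ℝ → V := fun t => x + t • (y - x)
  have hγK : MapsTo γ (Icc 0 1) K := fun t ht => hconv.add_smul_sub_mem hx hy ht
  have hγ : Continuous γ := by fun_prop
  have hγ0 : γ 0 = x := by simp [γ]
  have hc : ContinuousOn (fun t => Φ (γ t) (y - x)) (Icc 0 1) :=
    (hcont (y - x)).comp hγ.continuousOn hγK
  have hlim : Filter.Tendsto (fun t => Φ (γ t) (y - x)) (nhdsWithin 0 (Ioc 0 1))
      (nhds (Φ x (y - x))) := by
    have h := (hc 0 (left_mem_Icc.2 zero_le_one)).mono_left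
      (nhdsWithin_mono 0 Ioc_subset_Icc_self)
    simpa only [hγ0] using h
  -- The endpoint `0` is left out so that the factor `t` can be cancelled below.
  have : (nhdsWithin (0 : ℝ) (Ioc 0 1)).NeBot := by
    rw [nhdsWithin_Ioc_eq_nhdsGT zero_lt_one]
    infer_instance
  refine ge_of_tendsto hlim ?_
  filter_upwards [self_mem_nhdsWithin] with t ht
  have h := hminty _ (hγK (Ioc_subset_Icc_self ht))
  have hsub : γ t - x = t • (y - x) := by simp [γ]
  rw [hsub, map_smul, smul_eq_mul] at h
  exact nonneg_of_mul_nonneg_right h ht.1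

end VariationalInequality

/-- A differentiable convex function is minimal at `x` on `K` exactly if its derivative at `x` is
nonnegative in all directions pointing into `K`. -/
theorem ConvexOn.isMinOn_iff_fderiv_nonneg {E : Type*} [NormedAddCommGroup E] [NormedSpace ℝ E]
    {K : Set E} {g : E → ℝ} (hg : ConvexOn ℝ K g) {x : E} (hx : x ∈ K)
    (hd : DifferentiableAt ℝ g x) :
    IsMinOn g K x ↔ ∀ z ∈ K, 0 ≤ fderiv ℝ g x (z - x) := by
  constructor
  · intro h z hz
    exact h.localize.hasFDerivWithinAt_nonneg hd.hasFDerivAt.hasFDerivWithinAt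
      (sub_mem_posTangentConeAt_of_segment_subset (hg.1.segment_subset hx hz))
  · intro h z hz
    have hline : HasDerivAt (g ∘ AffineMap.lineMap x z) (fderiv ℝ g x (z - x)) (0 : ℝ) := by
      refine HasFDerivAt.comp_hasDerivAt (0 : ℝ) ?_ AffineMap.hasDerivAt_lineMap
      simpa using hd.hasFDerivAt
    have hconv := hg.comp_affineMap (AffineMap.lineMap (k := ℝ) x z)
    -- On the line through `x` and `z`, the derivative at `0` is at most the chord slope `g z - g
    -- x`.
    have hle := hconv.le_slope_of_hasDerivAt (x := 0) (y := 1) (by simpa using hx)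
      (by simpa using hz) zero_lt_one hline
    have h0 := (h z hz).trans hle
    simp [slope_def_field] at h0
    exact h0

namespace AggregativeGame

variable {n N : ℕ}

/-- A player's own decision and the aggregate, as a point of the domain of the player's cost. -/
theorem mem_prod_aggregateSet {G : AggregativeGame n N} {x : Fin N → EuclideanSpace ℝ (Fin n)}
    (hx : x ∈ G.jointSet) (i : Fin N) :
    (x i, x i + aggregateOthers x i) ∈ G.K i ×ˢ G.aggregateSet := by
  refine ⟨hx i (mem_univ i), ?_⟩
  have h : x i + aggregateOthers x i = ∑ j, x j :=
    Finset.add_sum_erase _ _ (Finset.mem_univ i)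
  simp only [h]
  exact Set.finsetSum_mem_finsetSum _ _ _ fun j _ => hx j (mem_univ j)

theorem hasFDerivAt_ownCost {G : AggregativeGame n N} (hG : G.IsConvexSmooth)
    {x : Fin N → EuclideanSpace ℝ (Fin n)} (hx : x ∈ G.jointSet) (i : Fin N) :
    HasFDerivAt (G.ownCost i x)
      ((fderiv ℝ (Function.uncurry (G.f i)) (x i, x i + aggregateOthers x i)).comp
        ((ContinuousLinearMap.id ℝ _).prod (ContinuousLinearMap.id ℝ _))) (x i) := by
  obtain ⟨U, hU, hsub, hf⟩ := hG.contDiffOn i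
  have hd : DifferentiableAt ℝ (Function.uncurry (G.f i)) (x i, x i + aggregateOthers x i) :=
    (hf.contDiffAt (hU.mem_nhds (hsub (mem_prod_aggregateSet hx i)))).differentiableAt one_ne_zero
  have hpair : HasFDerivAt (fun z => (z, z + aggregateOthers x i))
      ((ContinuousLinearMap.id ℝ _).prod (ContinuousLinearMap.id ℝ _)) (x i) :=
    (hasFDerivAt_id (x i)).prodMk ((hasFDerivAt_id (x i)).add_const _)
  exact hd.hasFDerivAt.comp (x i) hpair

theorem inner_phi (G : AggregativeGame n N) (x : Fin N → EuclideanSpace ℝ (Fin n)) (i : Fin N)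
    (v : EuclideanSpace ℝ (Fin n)) :
    inner ℝ v (G.phi x i) = fderiv ℝ (G.ownCost i x) (x i) v := by
  rw [real_inner_comm, phi, gradient, InnerProductSpace.toDual_symm_apply]

/-- The own decision enters both arguments of `G.f i`, so this is the derivative of a `C¹` function
in the direction `(v, v)`. -/
theorem continuousOn_inner_phi {G : AggregativeGame n N} (hG : G.IsConvexSmooth) (i : Fin N)
    (v : EuclideanSpace ℝ (Fin n)) :
    ContinuousOn (fun x => inner ℝ v (G.phi x i)) G.jointSet := by
  obtain ⟨U, hU, hsub, hf⟩ := hG.contDiffOn i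
  have hcont : Continuous fun x : Fin N → EuclideanSpace ℝ (Fin n) =>
      (x i, x i + aggregateOthers x i) := by
    unfold aggregateOthers
    fun_prop
  have h := ((hf.continuousOn_fderiv_of_isOpen hU le_rfl).comp hcont.continuousOn
    fun x hx => hsub (mem_prod_aggregateSet hx i)).clm_apply
      (continuousOn_const (c := (v, v)))
  refine h.congr fun x hx => ?_
  rw [inner_phi, (hasFDerivAt_ownCost hG hx i).fderiv]
  rfl

theorem isNashEquilibrium_iff_isVISolution {G : AggregativeGame n N} (hG : G.IsConvexSmooth)
    (x : Fin N → EuclideanSpace ℝ (Fin n)) : G.IsNashEquilibrium x ↔ G.IsVISolution x := by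
  refine and_congr_right fun hx => ?_
  have hmin : ∀ i, IsMinOn (G.ownCost i x) (G.K i) (x i) ↔
      ∀ z ∈ G.K i, 0 ≤ inner ℝ (z - x i) (G.phi x i) := fun i => by
    simp only [inner_phi]
    exact (hG.convexOn i x hx).isMinOn_iff_fderiv_nonneg (hx i (mem_univ i))
      (hasFDerivAt_ownCost hG hx i).differentiableAt
  simp only [hmin]
  constructor
  · exact fun h y hy => Finset.sum_nonneg fun i _ => h i _ (hy i (mem_univ i))
  · intro h i z hz
    -- Only block `i` deviates, so the other terms of the sum vanish.
    have hupd : Function.update x i z ∈ G.jointSet := by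
      intro j _
      rcases eq_or_ne j i with rfl | hj
      · simpa using hz
      · simpa [hj] using hx j (mem_univ j)
    have hsum := h _ hupd
    rw [Finset.sum_eq_single i (fun j _ hj => by simp [hj]) (by simp)] at hsum
    simpa using hsum

/-- The continuous linear functional `v ↦ vᵀ φ(x)` on the space of joint decisions. -/
noncomputable def phiFunctional (G : AggregativeGame n N)
    (x : Fin N → EuclideanSpace ℝ (Fin n)) : (Fin N → EuclideanSpace ℝ (Fin n)) →L[ℝ] ℝ :=
  ∑ i, (innerSL ℝ (G.phi x i)).comp (ContinuousLinearMap.proj i)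

theorem phiFunctional_apply (G : AggregativeGame n N) (x v : Fin N → EuclideanSpace ℝ (Fin n)) :
    G.phiFunctional x v = ∑ i, inner ℝ (v i) (G.phi x i) := by
  simp [phiFunctional, real_inner_comm]

theorem phiFunctional_sub_apply (G : AggregativeGame n N)
    (x y : Fin N → EuclideanSpace ℝ (Fin n)) :
    (G.phiFunctional x - G.phiFunctional y) (x - y) =
      ∑ i, inner ℝ (G.phi x i - G.phi y i) (x i - y i) := by
  rw [_root_.sub_apply, phiFunctional_apply, phiFunctional_apply,
    ← Finset.sum_sub_distrib]
  refine Finset.sum_congr rfl fun i _ => ?_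
  rw [← inner_sub_right, real_inner_comm, Pi.sub_apply]

theorem exists_isVISolution {G : AggregativeGame n N} (hG : G.IsConvexSmooth)
    (hφ : G.IsStrictlyMonotone) : ∃ x, G.IsVISolution x := by
  have hconv : Convex ℝ G.jointSet := convex_pi fun i _ => hG.convex i
  obtain ⟨x, hx, hminty⟩ := exists_forall_minty (univ_pi_nonempty_iff.2 hG.nonempty)
    (isCompact_univ_pi hG.isCompact) hconv G.phiFunctional fun x hx y hy => by
      rcases eq_or_ne x y with rfl | hne
      · simp
      · rw [phiFunctional_sub_apply]
        exact (hφ x hx y hy hne).le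
  refine ⟨x, hx, fun y hy => ?_⟩
  have h := variationalInequality_of_minty hconv G.phiFunctional (fun v => by
    simp only [phiFunctional_apply]
    exact continuousOn_finsetSum _ fun i _ => continuousOn_inner_phi hG i (v i)) hx hminty hy
  simpa only [phiFunctional_apply, Pi.sub_apply] using h

theorem IsVISolution.eq {G : AggregativeGame n N} (hφ : G.IsStrictlyMonotone)
    {x y : Fin N → EuclideanSpace ℝ (Fin n)} (hx : G.IsVISolution x) (hy : G.IsVISolution y) :
    x = y := by
  by_contra hne
  have h := hφ x hx.1 y hy.1 hne
  have h₁ := hx.2 y hy.1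
  have h₂ := hy.2 x hx.1
  simp only [← Pi.sub_apply, ← phiFunctional_apply] at h₁ h₂
  rw [← phiFunctional_sub_apply, _root_.sub_apply] at h
  rw [← neg_sub, map_neg] at h₁
  linarith

end AggregativeGame

theorem mainTheorem4 {n N : ℕ} (G : AggregativeGame n N) (hG : G.IsConvexSmooth)
    (hφ : G.IsStrictlyMonotone) :
    (∃! x, G.IsNashEquilibrium x) ∧ (∃! x, G.IsVISolution x) ∧
      ∀ x, G.IsNashEquilibrium x ↔ G.IsVISolution x := by
  have hiff := AggregativeGame.isNashEquilibrium_iff_isVISolution hG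
  have hVI : ∃! x, G.IsVISolution x := by
    obtain ⟨x, hx⟩ := AggregativeGame.exists_isVISolution hG hφ
    exact ⟨x, hx, fun y hy => hy.eq hφ hx⟩
  refine ⟨?_, hVI, hiff⟩
  simpa only [hiff] using hVI
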